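/- Let $\mathcal P=\langle X:\mathcal R\rangle$ be a group presentation, where $X$ is a set and $\mathcal R$ is a set of pairs $(l,r)$ of words in $X\cup X^{-1}$. We denote the images of $l$ and $r$ in the free group $F(X)$ by the same letters. Let $N$ be the normal closure in $F(X)$ of all $l^{-1}r$ with $(l,r)\in\mathcal R$, let $G=F(X)/N$ be the group presented by $\mathcal P$, and let $\theta:F(X)\to G$ be the quotient map. The relation module $N^{ab}$ is a right $G$-module through $[n]\cdot\theta(q)=[q^{-1}nq]$. The reduced Squier complex $\mathrm{Sq}^{\rho}(\mathcal P)$ is the $2$-complex with vertex set $F(X)$, with an edge $(p,l,r,q)$ from $plq$ to $prq$ for all $p,q\in F(X)$ and $(l,r)\in\mathcal R$, and, for all $p,q,p',q'\in F(X)$ and $(l,r),(l',r')\in\mathcal R$, with a $2$-cell that makes the edge paths $(p,l,r,qp'l'q')\,(prqp',l',r',q')$ and $(plqp',l',r',q')\,(p,l,r,qp'r'q')$ homotopic. Its fundamental group $\pi_1(\mathrm{Sq}^{\rho}(\mathcal P),1)$ at the vertex $1$ is abelian, and is a right $G$-module in which $\theta(u)$ acts by the map on homotopy classes of loops that is induced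 by $(p,l,r,q)\mapsto(u^{-1}p,l,r,qu)$. There are homomorphisms of right $G$-modules $$\pi_1(\mathrm{Sq}^{\rho}(\mathcal P),1)\longrightarrow\bigoplus_{(l,r)\in\mathcal R}\mathbb Z G\longrightarrow N^{ab}.$$ The first sends the class of an edge loop to the sum of the contributions of its edges, where $(p,l,r,q)$ contributes $\theta(q)$ in the summand of $(l,r)$, and the inverse of this edge contributes $-\theta(q)$. The second sends $\theta(q)$ in the summand of $(l,r)$ to the class of $q^{-1}(l^{-1}r)q$. Let $L$ be a subgroup of $G$, and let $G/L$ be the set of left cosets of $L$ in $G$. Applying $-\otimes_L\mathbb Z$ (with the trivial action of $L$ on $\mathbb Z$), and identifying $\mathbb ZG\otimes_L\mathbb Z$ with $\mathbb Z(G/L)$ by $g\otimes 1\mapsto gL$, we obtain homomorphisms of abelian groups $$\pi_1(\mathrm{Sq}^{\rho}(\mathcal P),1)\otimes_L\mathbb Z\xrightarrow{\ \alpha_L\ }\bigoplus_{(l,r)\in\mathcal R}\mathbb Z(G/L)\xrightarrow{\ \beta_L\ }N^{ab}\otimes_L\mathbb Z .$$ The presentation $\mathcal P$ is called $L$-Cockcroft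 if $\beta_L$ is an isomorphism. **Corollary** (Dyer). For every subgroup $L$ of $G$, the following are equivalent: (a) $\mathcal P$ is $L$-Cockcroft; (b) $\alpha_L$ is the zero map. -/

import Mathlib

universe u

/-- A group presentation `⟨X : ℛ⟩`: a set `ℛ` of pairs of (not necessarily reduced) words in
`X ∪ X⁻¹`.  The letter `(x, true)` stands for `x` and `(x, false)` for `x⁻¹`. -/
structure GroupPresentation (X : Type u) where
  rels : Set (List (X × Bool) × List (X × Bool))

namespace GroupPresentation

variable {X : Type u} (P : GroupPresentation X)

/-- The left side `l` of a relation `(l, r)`, as an element of `F(X)`. -/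
def lhs (ρ : P.rels) : FreeGroup X := FreeGroup.mk ρ.1.1

/-- The right side `r` of a relation `(l, r)`, as an element of `F(X)`. -/
def rhs (ρ : P.rels) : FreeGroup X := FreeGroup.mk ρ.1.2

/-- The relator `l⁻¹ r` in `F(X)` of a relation `(l, r)`. -/
def relator (ρ : P.rels) : FreeGroup X := (P.lhs ρ)⁻¹ * P.rhs ρ

/-- The normal closure `N` of the relators in `F(X)`. -/
abbrev N : Subgroup (FreeGroup X) := Subgroup.normalClosure (Set.range P.relator)

/-- The group `G = F(X) / N` presented by `P`. -/
abbrev G : Type u := FreeGroup X ⧸ P.N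

/-- The presentation map `θ : F(X) → G`. -/
abbrev θ : FreeGroup X →* P.G := QuotientGroup.mk' P.N

theorem relator_mem (ρ : P.rels) : P.relator ρ ∈ P.N :=
  Subgroup.subset_normalClosure ⟨ρ, rfl⟩

theorem θ_lhs (ρ : P.rels) : P.θ (P.lhs ρ) = P.θ (P.rhs ρ) :=
  (QuotientGroup.eq (s := P.N)).2 (P.relator_mem ρ)

/-! ### The reduced Squier complex -/

/-- An edge `(p, l, r, q)` of the reduced Squier complex, with `p, q ∈ F(X)` and `(l, r) ∈ ℛ`. -/
@[ext]
structure Edge where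
  p : FreeGroup X
  rel : P.rels
  q : FreeGroup X

variable {P}

/-- The edge `(p, l, r, q)` starts at the vertex `p l q` of the reduced Squier complex. -/
def Edge.source (e : P.Edge) : FreeGroup X := e.p * P.lhs e.rel * e.q

/-- The edge `(p, l, r, q)` ends at the vertex `p r q` of the reduced Squier complex. -/
def Edge.target (e : P.Edge) : FreeGroup X := e.p * P.rhs e.rel * e.q

variable (P) in
/-- An oriented edge: `(e, true)` is `e` and `(e, false)` is its formal inverse. -/
abbrev Step : Type u := P.Edge × Bool

def Step.start (s : P.Step) : FreeGroup X := if s.2 then s.1.source else s.1.target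

def Step.finish (s : P.Step) : FreeGroup X := if s.2 then s.1.target else s.1.source

def Step.inv (s : P.Step) : P.Step := (s.1, !s.2)

/-- `IsEdgePath a w b`: the list `w` of oriented edges is an edge path from `a` to `b`. -/
def IsEdgePath : FreeGroup X → List P.Step → FreeGroup X → Prop
  | a, [], b => a = b
  | a, s :: w, b => Step.start s = a ∧ IsEdgePath (Step.finish s) w b

/-- The elementary homotopies of edge paths: deletion of a pair of inverse edges, and replacement
of one side of a `2`-cell by the other.  There is one `2`-cell for each pair of relations
`(l, r)`, `(l', r')` and all `p, q, p', q' ∈ F(X)`, with sides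
`(p, l, r, q p' l' q') (p r q p', l', r', q')` and `(p l q p', l', r', q') (p, l, r, q p' r' q')`. -/
inductive ElementaryHomotopy : List P.Step → List P.Step → Prop
  | cancel (u v : List P.Step) (s : P.Step) :
      ElementaryHomotopy (u ++ s :: Step.inv s :: v) (u ++ v)
  | cell (u v : List P.Step) (p q p' q' : FreeGroup X) (ρ ρ' : P.rels) :
      ElementaryHomotopy
        (u ++ (⟨p, ρ, q * p' * P.lhs ρ' * q'⟩, true) ::
          (⟨p * P.rhs ρ * q * p', ρ', q'⟩, true) :: v)
        (u ++ (⟨p * P.lhs ρ * q * p', ρ', q'⟩, true) ::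
          (⟨p, ρ, q * p' * P.rhs ρ' * q'⟩, true) :: v)

/-- Homotopy, relative to the end points, of edge paths from `a` to `b`: the equivalence relation
generated by the elementary homotopies between edge paths from `a` to `b`. -/
def Homotopic (a b : FreeGroup X) : List P.Step → List P.Step → Prop :=
  Relation.EqvGen fun w w' => IsEdgePath a w b ∧ IsEdgePath a w' b ∧ ElementaryHomotopy w w'

/-- The inverse of an edge path. -/
def invPath (w : List P.Step) : List P.Step := (w.map Step.inv).reverse

/-- The action of `F(X)` on both sides of oriented edges: `u ▷ (p, l, r, q) ◁ v = (up, l, r, qv)`. -/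
def whisker (u v : FreeGroup X) (s : P.Step) : P.Step := (⟨u * s.1.p, s.1.rel, s.1.q * v⟩, s.2)

section EdgePaths

variable {a b c d : FreeGroup X} {w w' z z' : List P.Step}

@[simp] theorem Step.start_inv (s : P.Step) : Step.start (Step.inv s) = Step.finish s := by
  rcases s with ⟨e, _ | _⟩ <;> rfl

@[simp] theorem Step.finish_inv (s : P.Step) : Step.finish (Step.inv s) = Step.start s := by
  rcases s with ⟨e, _ | _⟩ <;> rfl

@[simp] theorem Step.inv_inv (s : P.Step) : Step.inv (Step.inv s) = s := by
  rcases s with ⟨e, _ | _⟩ <;> rfl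

theorem start_whisker (u v : FreeGroup X) (s : P.Step) :
    Step.start (whisker u v s) = u * Step.start s * v := by
  rcases s with ⟨e, _ | _⟩ <;>
    simp [whisker, Step.start, Edge.source, Edge.target, mul_assoc]

theorem finish_whisker (u v : FreeGroup X) (s : P.Step) :
    Step.finish (whisker u v s) = u * Step.finish s * v := by
  rcases s with ⟨e, _ | _⟩ <;>
    simp [whisker, Step.finish, Edge.source, Edge.target, mul_assoc]

theorem whisker_inv (u v : FreeGroup X) (s : P.Step) :
    whisker u v (Step.inv s) = Step.inv (whisker u v s) := rfl

theorem isEdgePath_append :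
    IsEdgePath a (w ++ z) c ↔ ∃ b, IsEdgePath a w b ∧ IsEdgePath b z c := by
  induction w generalizing a with
  | nil => simp [IsEdgePath]
  | cons s w ih => simp [IsEdgePath, ih, and_assoc]

theorem IsEdgePath.append (hw : IsEdgePath a w b) (hz : IsEdgePath b z c) :
    IsEdgePath a (w ++ z) c := isEdgePath_append.2 ⟨b, hw, hz⟩

theorem IsEdgePath.invPath (hw : IsEdgePath a w b) :
    IsEdgePath b (GroupPresentation.invPath w) a := by
  induction w generalizing a with
  | nil => exact Eq.symm hw
  | cons s w ih =>
    have h := ih hw.2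
    have : GroupPresentation.invPath (s :: w) = GroupPresentation.invPath w ++ [Step.inv s] := by
      simp [GroupPresentation.invPath]
    rw [this]
    exact h.append ⟨Step.start_inv s, by simpa [IsEdgePath] using hw.1⟩

theorem IsEdgePath.whisker (u v : FreeGroup X) (hw : IsEdgePath a w b) :
    IsEdgePath (u * a * v) (w.map (GroupPresentation.whisker u v)) (u * b * v) := by
  induction w generalizing a with
  | nil => cases hw; rfl
  | cons s w ih =>
    refine ⟨by rw [start_whisker, hw.1], ?_⟩
    rw [finish_whisker]
    exact ih hw.2

theorem invPath_append (w z : List P.Step) : invPath (w ++ z) = invPath z ++ invPath w := by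
  simp [invPath]

@[simp] theorem invPath_invPath (w : List P.Step) : invPath (invPath w) = w := by
  simp [invPath, Function.comp_def]

theorem map_whisker_invPath (u v : FreeGroup X) (w : List P.Step) :
    (invPath w).map (whisker u v) = invPath (w.map (whisker u v)) := by
  simp [invPath, Function.comp_def, whisker_inv]

namespace Homotopic

theorem refl (a b : FreeGroup X) (w : List P.Step) : Homotopic a b w w := Relation.EqvGen.refl w

theorem symm (h : Homotopic a b w w') : Homotopic a b w' w := Relation.EqvGen.symm _ _ h

theorem trans {w'' : List P.Step} (h : Homotopic a b w w') (h' : Homotopic a b w' w'') :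
    Homotopic a b w w'' := Relation.EqvGen.trans _ _ _ h h'

theorem lift {f : List P.Step → List P.Step}
    (hf : ∀ w, IsEdgePath a w b → IsEdgePath c (f w) d)
    (he : ∀ w w', ElementaryHomotopy w w' → ElementaryHomotopy (f w) (f w'))
    (h : Homotopic a b w w') : Homotopic c d (f w) (f w') := by
  induction h with
  | rel x y h => exact .rel _ _ ⟨hf _ h.1, hf _ h.2.1, he _ _ h.2.2⟩
  | refl x => exact Relation.EqvGen.refl _
  | symm x y _ ih => exact ih.symm
  | trans x y z _ _ h₁ h₂ => exact h₁.trans h₂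

theorem append_left (hz : IsEdgePath a z b) (h : Homotopic b c w w') :
    Homotopic a c (z ++ w) (z ++ w') := by
  refine h.lift (f := fun w => z ++ w) (fun w hw => hz.append hw) ?_
  rintro _ _ (⟨u, v, s⟩ | ⟨u, v, p, q, p', q', ρ, ρ'⟩)
  · simpa using ElementaryHomotopy.cancel (z ++ u) v s
  · simpa using ElementaryHomotopy.cell (z ++ u) v p q p' q' ρ ρ'

theorem append_right (hz : IsEdgePath b z c) (h : Homotopic a b w w') :
    Homotopic a c (w ++ z) (w' ++ z) := by
  refine h.lift (f := fun w => w ++ z) (fun w hw => hw.append hz) ?_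
  rintro _ _ (⟨u, v, s⟩ | ⟨u, v, p, q, p', q', ρ, ρ'⟩)
  · simpa using ElementaryHomotopy.cancel u (v ++ z) s
  · simpa using ElementaryHomotopy.cell u (v ++ z) p q p' q' ρ ρ'

theorem whisker (x y : FreeGroup X) (h : Homotopic a b w w') :
    Homotopic (x * a * y) (x * b * y) (w.map (GroupPresentation.whisker x y))
      (w'.map (GroupPresentation.whisker x y)) := by
  refine h.lift (f := fun w => w.map (GroupPresentation.whisker x y))
    (fun w hw => hw.whisker x y) ?_
  rintro _ _ (⟨u, v, s⟩ | ⟨u, v, p, q, p', q', ρ, ρ'⟩)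
  · simpa [whisker_inv] using ElementaryHomotopy.cancel (u.map (GroupPresentation.whisker x y))
      (v.map (GroupPresentation.whisker x y)) (GroupPresentation.whisker x y s)
  · simpa [GroupPresentation.whisker, mul_assoc] using
      ElementaryHomotopy.cell (u.map (GroupPresentation.whisker x y))
        (v.map (GroupPresentation.whisker x y)) (x * p) q p' (q' * y) ρ ρ'

theorem append_invPath (hw : IsEdgePath a w b) : Homotopic a a (w ++ invPath w) [] := by
  induction w generalizing a with
  | nil => exact refl _ _ _
  | cons s w ih =>
    have hs : IsEdgePath a [s] (Step.finish s) := ⟨hw.1, rfl⟩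
    have hs' : IsEdgePath (Step.finish s) [Step.inv s] a :=
      ⟨Step.start_inv s, by simpa [IsEdgePath] using hw.1⟩
    have h₁ := append_left hs (append_right hs' (ih hw.2))
    have h₂ : Homotopic a a ([s] ++ ([] ++ [Step.inv s])) [] :=
      .rel _ _ ⟨hs.append hs', rfl, by simpa using ElementaryHomotopy.cancel [] [] s⟩
    refine trans ?_ h₂
    simpa [invPath] using h₁

theorem invPath_append_self (hw : IsEdgePath a w b) : Homotopic b b (invPath w ++ w) [] := by
  simpa using append_invPath hw.invPath

/-- Turning a homotopy commutative square. -/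
theorem square {x y₁ y₂ t : FreeGroup X} {A B C D : List P.Step}
    (hA : IsEdgePath x A y₁) (hB : IsEdgePath y₁ B t) (hC : IsEdgePath x C y₂)
    (hD : IsEdgePath y₂ D t) (h : Homotopic x t (A ++ B) (C ++ D)) :
    Homotopic y₁ y₂ (invPath A ++ C) (B ++ invPath D) := by
  have h₁ : Homotopic y₁ y₂ (invPath A ++ C) (invPath A ++ C ++ (D ++ invPath D)) := by
    simpa using append_left (hA.invPath.append hC) (append_invPath hD).symm
  have h₂ : Homotopic y₁ y₂ (invPath A ++ (C ++ D) ++ invPath D)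
      (invPath A ++ (A ++ B) ++ invPath D) :=
    append_right hD.invPath (append_left hA.invPath h.symm)
  have h₃ : Homotopic y₁ y₂ (invPath A ++ A ++ (B ++ invPath D)) ([] ++ (B ++ invPath D)) :=
    append_right (hB.append hD.invPath) (invPath_append_self hA)
  simp only [List.append_assoc, List.nil_append] at h₁ h₂ h₃ ⊢
  exact h₁.trans (h₂.trans h₃)

theorem inv (hw : IsEdgePath a w b) (hw' : IsEdgePath a w' b) (h : Homotopic a b w w') :
    Homotopic b a (invPath w) (invPath w') := by
  have := square (B := []) (C := []) (D := w') hw rfl (rfl : a = a) hw' (by simpa using h)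
  simpa using this

end Homotopic

/-- The two horizontal compositions `w * z` and `w ⊛ z` of edge paths are homotopic. -/
def Interchange (a b c d : FreeGroup X) (w z : List P.Step) : Prop :=
  Homotopic (a * c) (b * d) (w.map (whisker 1 c) ++ z.map (whisker b 1))
    (z.map (whisker a 1) ++ w.map (whisker 1 d))

theorem IsEdgePath.whisker_left (u : FreeGroup X) (hw : IsEdgePath a w b) :
    IsEdgePath (u * a) (w.map (GroupPresentation.whisker u 1)) (u * b) := by
  simpa using hw.whisker u 1

theorem IsEdgePath.whisker_right (v : FreeGroup X) (hw : IsEdgePath a w b) :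
    IsEdgePath (a * v) (w.map (GroupPresentation.whisker 1 v)) (b * v) := by
  simpa using hw.whisker 1 v

theorem Interchange.inv_left (hw : IsEdgePath a w b) (hz : IsEdgePath c z d)
    (h : Interchange a b c d w z) : Interchange b a c d (invPath w) z := by
  have := Homotopic.square (hw.whisker_right c) (hz.whisker_left b) (hz.whisker_left a)
    (hw.whisker_right d) h
  rw [Interchange, map_whisker_invPath, map_whisker_invPath]
  exact this

theorem Interchange.inv_right (hw : IsEdgePath a w b) (hz : IsEdgePath c z d)
    (h : Interchange a b c d w z) : Interchange a b d c w (invPath z) := by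
  have := Homotopic.square (hz.whisker_left a) (hw.whisker_right d) (hw.whisker_right c)
    (hz.whisker_left b) h.symm
  rw [Interchange, map_whisker_invPath, map_whisker_invPath]
  exact this.symm

theorem interchange_edge (e f : P.Edge) :
    Interchange e.source e.target f.source f.target [(e, true)] [(f, true)] := by
  have he : IsEdgePath e.source [((e, true) : P.Step)] e.target := ⟨rfl, rfl⟩
  have hf : IsEdgePath f.source [((f, true) : P.Step)] f.target := ⟨rfl, rfl⟩
  refine .rel _ _ ⟨(he.whisker_right _).append (hf.whisker_left _),
    (hf.whisker_left _).append (he.whisker_right _), ?_⟩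
  simpa [whisker, Edge.source, Edge.target, mul_assoc] using
    ElementaryHomotopy.cell [] [] e.p e.q f.p f.q e.rel f.rel

theorem interchange_step (s t : P.Step) :
    Interchange (Step.start s) (Step.finish s) (Step.start t) (Step.finish t) [s] [t] := by
  obtain ⟨e, x⟩ := s
  obtain ⟨f, y⟩ := t
  have he : IsEdgePath e.source [((e, true) : P.Step)] e.target := ⟨rfl, rfl⟩
  have hf : IsEdgePath f.source [((f, true) : P.Step)] f.target := ⟨rfl, rfl⟩
  cases x <;> cases y
  · exact ((interchange_edge e f).inv_left he hf).inv_right he.invPath hf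
  · exact (interchange_edge e f).inv_left he hf
  · exact (interchange_edge e f).inv_right he hf
  · exact interchange_edge e f

theorem interchange_left (t : P.Step) (hw : IsEdgePath a w b) :
    Interchange a b (Step.start t) (Step.finish t) w [t] := by
  have ht : IsEdgePath (Step.start t) [t] (Step.finish t) := ⟨rfl, rfl⟩
  induction w generalizing a with
  | nil => cases hw; simpa [Interchange] using Homotopic.refl _ _ _
  | cons s w ih =>
    obtain ⟨rfl, hw⟩ := hw
    have hs : IsEdgePath (Step.start s) [s] (Step.finish s) := ⟨rfl, rfl⟩
    have h₁ := Homotopic.append_left (hs.whisker_right (Step.start t)) (ih hw)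
    have h₂ := Homotopic.append_right (hw.whisker_right (Step.finish t)) (interchange_step s t)
    have h₃ := h₁.trans (by simpa using h₂)
    simpa [Interchange] using h₃

theorem interchange (hw : IsEdgePath a w b) (hz : IsEdgePath c z d) :
    Interchange a b c d w z := by
  induction z generalizing c with
  | nil => cases hz; simpa [Interchange] using Homotopic.refl _ _ _
  | cons t z ih =>
    obtain ⟨rfl, hz⟩ := hz
    have ht : IsEdgePath (Step.start t) [t] (Step.finish t) := ⟨rfl, rfl⟩
    have h₁ := Homotopic.append_right (hz.whisker_left b) (interchange_left t hw)
    have h₂ := Homotopic.append_left (ht.whisker_left a) (ih hz)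
    simp only [List.append_assoc] at h₁
    have h₃ := h₁.trans h₂
    simpa [Interchange] using h₃

theorem map_whisker_one (w : List P.Step) : w.map (whisker 1 1) = w := by
  have : (whisker 1 1 : P.Step → P.Step) = id := by
    funext s; simp [whisker]
  simp [this]

end EdgePaths

/-! ### The fundamental group at the vertex `1` -/

variable (P)

/-- Homotopy of edge loops at the vertex `1`. -/
def loopSetoid : Setoid {w : List P.Step // IsEdgePath 1 w 1} where
  r w w' := Homotopic 1 1 w.1 w'.1
  iseqv := ⟨fun _ => Homotopic.refl _ _ _, fun h => h.symm, fun h h' => h.trans h'⟩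

/-- The fundamental group `π₁(Sq(P), 1)` of the reduced Squier complex: homotopy classes of edge
loops at the vertex `1`. -/
def Pi1 : Type u := Quotient P.loopSetoid

variable {P}

/-- The homotopy class of an edge loop at `1`. -/
def Pi1.mk (w : List P.Step) (hw : IsEdgePath 1 w 1) : P.Pi1 := Quotient.mk P.loopSetoid ⟨w, hw⟩

theorem Pi1.sound {w w' : List P.Step} {hw : IsEdgePath 1 w 1} {hw' : IsEdgePath 1 w' 1}
    (h : Homotopic 1 1 w w') : Pi1.mk w hw = Pi1.mk w' hw' := Quotient.sound h

theorem Pi1.ind {C : P.Pi1 → Prop} (h : ∀ w hw, C (Pi1.mk w hw)) (x : P.Pi1) : C x :=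
  Quotient.ind (fun w => h w.1 w.2) x

/-- The group law is concatenation of loops; the group is commutative by the interchange law. -/
instance : CommGroup P.Pi1 where
  mul := Quotient.map₂ (fun w z => ⟨w.1 ++ z.1, w.2.append z.2⟩) fun _ w' h z _ h' =>
    Homotopic.trans (Homotopic.append_right z.2 h) (Homotopic.append_left w'.2 h')
  one := Pi1.mk [] rfl
  inv := Quotient.map (fun w => ⟨invPath w.1, w.2.invPath⟩) fun w w' h =>
    Homotopic.inv w.2 w'.2 h
  mul_assoc x y z := by
    induction x using Pi1.ind; induction y using Pi1.ind; induction z using Pi1.ind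
    exact Pi1.sound (by simpa using Homotopic.refl _ _ _)
  one_mul x := by
    induction x using Pi1.ind
    exact Pi1.sound (Homotopic.refl _ _ _)
  mul_one x := by
    induction x using Pi1.ind
    exact Pi1.sound (by simpa using Homotopic.refl _ _ _)
  inv_mul_cancel x := by
    induction x using Pi1.ind with | _ w hw
    exact Pi1.sound (Homotopic.invPath_append_self hw)
  mul_comm x y := by
    induction x using Pi1.ind with | _ w hw
    induction y using Pi1.ind with | _ z hz
    refine Pi1.sound ?_
    have := interchange hw hz
    simpa only [Interchange, map_whisker_one, one_mul] using this

theorem Pi1.mk_mul_mk {w z : List P.Step} (hw : IsEdgePath 1 w 1) (hz : IsEdgePath 1 z 1) :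
    Pi1.mk w hw * Pi1.mk z hz = Pi1.mk (w ++ z) (hw.append hz) := rfl

theorem IsEdgePath.conj {w : List P.Step} (g : FreeGroup X) (hw : IsEdgePath 1 w 1) :
    IsEdgePath 1 (w.map (GroupPresentation.whisker g g⁻¹)) 1 := by
  simpa using hw.whisker g g⁻¹

theorem whisker_whisker (x y x' y' : FreeGroup X) (s : P.Step) :
    whisker x y (whisker x' y' s) = whisker (x * x') (y' * y) s := by
  simp [whisker, mul_assoc]

/-- The endomorphism `α ↦ g ▷ α ◁ g⁻¹` of `π₁(Sq(P), 1)`, for `g ∈ F(X)`. -/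
def Pi1.conjHom (g : FreeGroup X) : P.Pi1 →* P.Pi1 where
  toFun := Quotient.map (fun w => ⟨w.1.map (whisker g g⁻¹), w.2.conj g⟩) fun _ _ h => by
    have := Homotopic.whisker g g⁻¹ h
    rw [mul_one, mul_inv_cancel] at this
    exact this
  map_one' := rfl
  map_mul' x y := by
    induction x using Pi1.ind with | _ w hw
    induction y using Pi1.ind with | _ z hz
    exact Pi1.sound (by simpa using Homotopic.refl _ _ _)

theorem Pi1.conjHom_mk (g : FreeGroup X) {w : List P.Step} (hw : IsEdgePath 1 w 1) :
    Pi1.conjHom g (Pi1.mk w hw) = Pi1.mk (w.map (whisker g g⁻¹)) (hw.conj g) := rfl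

variable (P) in
/-- The (left) action `g ↦ (α ↦ g ▷ α ◁ g⁻¹)` of `F(X)` on `π₁(Sq(P), 1)`. -/
def Pi1.conjAction : FreeGroup X →* Monoid.End P.Pi1 where
  toFun := Pi1.conjHom
  map_one' := by
    ext x
    induction x using Pi1.ind with | _ w hw
    exact Pi1.sound (by simpa [map_whisker_one] using Homotopic.refl _ _ _)
  map_mul' g h := by
    ext x
    induction x using Pi1.ind with | _ w hw
    refine Pi1.sound ?_
    have : (w.map (whisker h h⁻¹)).map (whisker g g⁻¹) = w.map (whisker (g * h) (g * h)⁻¹) := by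
      simp [Function.comp_def, whisker_whisker]
    rw [this]
    exact Homotopic.refl _ _ _

/-- The relators, hence `N`, act trivially on `π₁(Sq(P), 1)`. -/
theorem Pi1.N_le_ker : P.N ≤ (Pi1.conjAction P).ker := by
  refine Subgroup.normalClosure_le_normal ?_
  rintro _ ⟨ρ, rfl⟩
  rw [SetLike.mem_coe, MonoidHom.mem_ker]
  ext x
  induction x using Pi1.ind with | _ w hw
  set n := P.relator ρ with hn
  -- the edge `(l⁻¹, l, r, 1)` from `1` to `n`
  have hβ : IsEdgePath 1 [((⟨(P.lhs ρ)⁻¹, ρ, 1⟩, true) : P.Step)] n := by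
    simp [IsEdgePath, Step.start, Step.finish, Edge.source, Edge.target, hn, relator]
  set β : List P.Step := [(⟨(P.lhs ρ)⁻¹, ρ, 1⟩, true)]
  have h₁ : Homotopic 1 n (w ++ β) (β ++ w.map (whisker 1 n)) := by
    simpa only [Interchange, map_whisker_one, one_mul] using interchange hw hβ
  have h₂ : Homotopic 1 n (β ++ w.map (whisker n 1)) (w ++ β) := by
    simpa only [Interchange, map_whisker_one, one_mul, mul_one] using interchange hβ hw
  have hl : IsEdgePath n (w.map (whisker n 1)) n := by simpa using hw.whisker_left n
  have hr : IsEdgePath n (w.map (whisker 1 n)) n := by simpa using hw.whisker_right n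
  have h₃ := Homotopic.append_left hβ.invPath (h₂.trans h₁)
  have h₄ : Homotopic n n (w.map (whisker n 1)) (w.map (whisker 1 n)) := by
    have e₁ := Homotopic.append_right hl (Homotopic.invPath_append_self hβ)
    have e₂ := Homotopic.append_right hr (Homotopic.invPath_append_self hβ)
    simp only [List.append_assoc, List.nil_append] at e₁ e₂
    exact e₁.symm.trans (h₃.trans e₂)
  have h₅ := h₄.whisker 1 n⁻¹
  simp only [List.map_map, Function.comp_def, whisker_whisker, one_mul, mul_inv_cancel] at h₅
  rw [map_whisker_one] at h₅
  exact Pi1.sound h₅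

/-! ### The three `G`-modules

The modules in question are naturally right `G`-modules.  A right `G`-module `M` is encoded as the
representation in which `g` acts by `m ↦ m · g⁻¹`.  With this convention `M ⊗_L ℤ`, for a subgroup
`L` of `G` acting trivially on `ℤ`, is the module of coinvariants of the restriction to `L`, that
is `M` modulo the subgroup generated by all `m · h - m` with `m ∈ M` and `h ∈ L`. -/

/-- An action of a group on a commutative group, as a representation over `ℤ`. -/
def repOfAction {Γ A : Type*} [Group Γ] [CommGroup A] (φ : Γ →* Monoid.End A) :
    Representation ℤ Γ (Additive A) where
  toFun g := (MonoidHom.toAdditive (φ g)).toIntLinearMap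
  map_one' := by rw [map_one]; rfl
  map_mul' g h := by rw [map_mul]; rfl

variable (P)

/-- `π₁(Sq(P), 1)` as a `G`-module: the right action of `θ(q)` is `α ↦ q⁻¹ ▷ α ◁ q`. -/
def pi1Rep : Representation ℤ P.G (Additive P.Pi1) :=
  repOfAction (QuotientGroup.lift P.N (Pi1.conjAction P) Pi1.N_le_ker)

/-- The conjugation action `g ↦ (n ↦ g n g⁻¹)` of `F(X)` on `N^ab`. -/
def relationAction : FreeGroup X →* Monoid.End (Abelianization P.N) where
  toFun g := Abelianization.map (MulAut.conjNormal g : MulAut P.N).toMonoidHom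
  map_one' := by
    rw [map_one]
    exact Abelianization.hom_ext _ _ rfl
  map_mul' g h := by
    rw [map_mul]
    exact Abelianization.hom_ext _ _ rfl

theorem N_le_ker_relationAction : P.N ≤ P.relationAction.ker := by
  intro n hn
  rw [MonoidHom.mem_ker]
  refine Abelianization.hom_ext _ _ (MonoidHom.ext fun m => ?_)
  change Abelianization.of (MulAut.conjNormal n m) = Abelianization.of m
  have : (MulAut.conjNormal n m : P.N) = ⟨n, hn⟩ * m * ⟨n, hn⟩⁻¹ := by
    ext; simp
  rw [this, map_mul, map_mul, map_inv, mul_comm (Abelianization.of _), mul_assoc,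
    mul_inv_cancel, mul_one]

/-- The relation module `N^ab`: the right action of `θ(q)` is induced by `n ↦ q⁻¹ n q`. -/
def relationModuleRep : Representation ℤ P.G (Additive (Abelianization P.N)) :=
  repOfAction (QuotientGroup.lift P.N P.relationAction P.N_le_ker_relationAction)

/-- The class of an element of `N` in the relation module `N^ab`. -/
def relationClass (n : P.N) : Additive (Abelianization P.N) :=
  Additive.ofMul (Abelianization.of n)

/-- The free module `⨁_{ℛ} ℤG`, with right action of `h` given by `g ↦ g h` on the basis `G` of
each summand. -/
noncomputable def freeRep : Representation ℤ P.G (P.rels →₀ (P.G →₀ ℤ)) where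
  toFun h := Finsupp.mapRange.linearMap (Finsupp.lmapDomain ℤ ℤ fun g => g * h⁻¹)
  map_one' := by ext; simp
  map_mul' g h := by ext; simp [mul_assoc]

variable {P}

theorem freeRep_single (h : P.G) (ρ : P.rels) (g : P.G) (n : ℤ) :
    P.freeRep h (Finsupp.single ρ (Finsupp.single g n)) =
      Finsupp.single ρ (Finsupp.single (g * h⁻¹) n) := by
  simp [freeRep]

/-! ### The sequence `π₁(Sq(P), 1) → ⨁ ℤG → N^ab` -/

/-- The contribution of an oriented edge: the edge `(p, l, r, q)` contributes `θ(q)` in the summand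
of the relation `(l, r)`, and its inverse contributes the negative. -/
noncomputable def stepValue (s : P.Step) : P.rels →₀ (P.G →₀ ℤ) :=
  (if s.2 then 1 else -1 : ℤ) • Finsupp.single s.1.rel (Finsupp.single (P.θ s.1.q) 1)

/-- The sum of the contributions of the edges of an edge path. -/
noncomputable def pathValue (w : List P.Step) : P.rels →₀ (P.G →₀ ℤ) := (w.map stepValue).sum

theorem pathValue_append (w z : List P.Step) :
    pathValue (w ++ z) = pathValue w + pathValue z := by
  simp [pathValue]

theorem stepValue_inv (s : P.Step) : stepValue (Step.inv s) = -stepValue s := by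
  rcases s with ⟨e, _ | _⟩ <;> simp [stepValue, Step.inv]

theorem ElementaryHomotopy.pathValue_eq {w w' : List P.Step} (h : ElementaryHomotopy w w') :
    pathValue w = pathValue w' := by
  rcases h with ⟨u, v, s⟩ | ⟨u, v, p, q, p', q', ρ, ρ'⟩
  · simp [pathValue, stepValue_inv]
  · have h : P.θ (q * p' * P.lhs ρ' * q') = P.θ (q * p' * P.rhs ρ' * q') := by
      simp only [map_mul, θ_lhs]
    simp only [pathValue, List.map_append, List.map_cons, List.sum_append, List.sum_cons,
      stepValue, h]
    abel

theorem Homotopic.pathValue_eq {a b : FreeGroup X} {w w' : List P.Step}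
    (h : Homotopic a b w w') : pathValue w = pathValue w' := by
  induction h with
  | rel x y h => exact h.2.2.pathValue_eq
  | refl x => rfl
  | symm x y _ ih => exact ih.symm
  | trans x y z _ _ h₁ h₂ => exact h₁.trans h₂

theorem pathValue_whisker (h : FreeGroup X) (w : List P.Step) :
    pathValue (w.map (whisker h h⁻¹)) = P.freeRep (P.θ h) (pathValue w) := by
  induction w with
  | nil => simp [pathValue]
  | cons s w ih =>
    have : stepValue (whisker h h⁻¹ s) = P.freeRep (P.θ h) (stepValue s) := by
      simp only [stepValue, map_smul, freeRep_single, whisker, map_mul, map_inv]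
      rfl
    simp only [pathValue, List.map_cons, List.sum_cons, map_add] at ih ⊢
    rw [this, ih]

variable (P)

/-- The homomorphism `π₁(Sq(P), 1) → ⨁_{ℛ} ℤG` that sends the class of an edge loop to the sum of
the contributions of its edges. -/
noncomputable def identityHom : Additive P.Pi1 →+ (P.rels →₀ (P.G →₀ ℤ)) where
  toFun x := Quotient.lift (s := P.loopSetoid) (fun w => pathValue w.1)
    (fun _ _ h => Homotopic.pathValue_eq h) x.toMul
  map_zero' := rfl
  map_add' x y := by
    induction x using Additive.rec with | _ x
    induction y using Additive.rec with | _ y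
    induction x using Pi1.ind with | _ w hw
    induction y using Pi1.ind with | _ z hz
    exact pathValue_append w z

/-- The map of `G`-modules `π₁(Sq(P), 1) → ⨁_{ℛ} ℤG`.  It is the inclusion of `π₁(Sq(P), 1)`
in the crossed module of homotopy classes of paths starting at `1`, which is free on the edges
`(l⁻¹, l, r, 1)`, followed by abelianisation: the edge `(q⁻¹l⁻¹, l, r, q)` is the translate by `q`
of the basis element `(l⁻¹, l, r, 1)`, and it is sent to the translate by `θ(q)` of the basis
element of the relation `(l, r)`. -/
noncomputable def identityMap : P.pi1Rep.IntertwiningMap P.freeRep where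
  toLinearMap := P.identityHom.toIntLinearMap
  isIntertwining' g := by
    obtain ⟨h, rfl⟩ := QuotientGroup.mk'_surjective P.N g
    refine LinearMap.ext fun x => ?_
    induction x using Additive.rec with | _ x
    induction x using Pi1.ind with | _ w hw
    exact pathValue_whisker h w

/-- The map of `G`-modules `⨁_{ℛ} ℤG → N^ab` that sends `θ(q)` in the summand of `(l, r)` to the
class of `q⁻¹ (l⁻¹ r) q`. -/
noncomputable def relationMap : P.freeRep.IntertwiningMap P.relationModuleRep where
  toLinearMap := Finsupp.lsum ℤ fun ρ => Finsupp.linearCombination ℤ fun g =>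
    P.relationModuleRep g⁻¹ (P.relationClass ⟨P.relator ρ, P.relator_mem ρ⟩)
  isIntertwining' h := by
    ext ρ g : 4
    simp only [LinearMap.comp_apply, Finsupp.lsingle_apply, freeRep_single]
    rw [Finsupp.lsum_single, Finsupp.lsum_single, Finsupp.linearCombination_single,
      Finsupp.linearCombination_single, one_smul, one_smul, mul_inv_rev, inv_inv, map_mul]
    rfl

theorem relationMap_single (ρ : P.rels) (q : FreeGroup X) :
    P.relationMap (Finsupp.single ρ (Finsupp.single (P.θ q) 1)) =
      P.relationClass ⟨q⁻¹ * P.relator ρ * q, by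
        simpa using Subgroup.normalClosure_normal.conj_mem _ (P.relator_mem ρ) q⁻¹⟩ := by
  change Finsupp.lsum ℤ _ _ = _
  rw [Finsupp.lsum_single, Finsupp.linearCombination_single, one_smul, ← map_inv]
  change P.relationClass (MulAut.conjNormal q⁻¹ _) = _
  congr 1
  ext
  simp

/-! ### Tensoring with `ℤ` over a subgroup -/

variable {P}

/-- `M ⊗_L ℤ`, for a subgroup `L` of `G`: the coinvariants of the restriction to `L`. -/
abbrev TensorInt {M : Type*} [AddCommGroup M] (τ : Representation ℤ P.G M) (L : Subgroup P.G) : Type _ :=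
  Representation.Coinvariants (τ.comp L.subtype)

/-- The map `f ⊗_L ℤ : M ⊗_L ℤ → M' ⊗_L ℤ` induced by a map of `G`-modules `f : M → M'`. -/
noncomputable def tensorIntMap {M M' : Type*} [AddCommGroup M] [AddCommGroup M']
    {τ : Representation ℤ P.G M} {τ' : Representation ℤ P.G M'}
    (f : τ.IntertwiningMap τ') (L : Subgroup P.G) : TensorInt τ L →ₗ[ℤ] TensorInt τ' L :=
  Representation.Coinvariants.map (τ.comp L.subtype) (τ'.comp L.subtype)
    ⟨f.toLinearMap, fun h => f.isIntertwining' h⟩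

variable (P)

/-- The class of `g` in the summand of the relation `ρ` of `(⨁_{ℛ} ℤG) ⊗_L ℤ`: it depends only
on the coset `gL`. -/
noncomputable def cosetClass (L : Subgroup P.G) (ρ : P.rels) (c : P.G ⧸ L) :
    TensorInt P.freeRep L :=
  Quotient.liftOn' c
    (fun g => Representation.Coinvariants.mk (P.freeRep.comp L.subtype)
      (Finsupp.single ρ (Finsupp.single g 1)))
    (fun g g' h => by
      rw [QuotientGroup.leftRel_apply] at h
      rw [← Representation.Coinvariants.mk_self_apply _ (⟨_, h⟩ : L)⁻¹]
      simp [freeRep_single])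

theorem cosetClass_mk (L : Subgroup P.G) (ρ : P.rels) (g : P.G) :
    P.cosetClass L ρ (g : P.G ⧸ L) = Representation.Coinvariants.mk (P.freeRep.comp L.subtype)
      (Finsupp.single ρ (Finsupp.single g 1)) := rfl

/-- The map `⨁_{ℛ} ℤG → ⨁_{ℛ} ℤ(G/L)` induced by `g ↦ gL`. -/
noncomputable def cosetMap (L : Subgroup P.G) :
    (P.rels →₀ (P.G →₀ ℤ)) →ₗ[ℤ] (P.rels →₀ ((P.G ⧸ L) →₀ ℤ)) :=
  Finsupp.mapRange.linearMap (Finsupp.lmapDomain ℤ ℤ fun g : P.G => (g : P.G ⧸ L))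

theorem cosetMap_single (L : Subgroup P.G) (ρ : P.rels) (g : P.G) (n : ℤ) :
    P.cosetMap L (Finsupp.single ρ (Finsupp.single g n)) =
      Finsupp.single ρ (Finsupp.single (g : P.G ⧸ L) n) := by
  simp [cosetMap]

theorem cosetMap_freeRep (L : Subgroup P.G) (h : L) :
    P.cosetMap L ∘ₗ P.freeRep.comp L.subtype h = P.cosetMap L := by
  refine Finsupp.lhom_ext' fun ρ => Finsupp.lhom_ext fun g n => ?_
  change P.cosetMap L (P.freeRep (h : P.G) (Finsupp.single ρ (Finsupp.single g n))) =
    P.cosetMap L (Finsupp.single ρ (Finsupp.single g n))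
  rw [freeRep_single, cosetMap_single, cosetMap_single,
    QuotientGroup.mk_mul_of_mem g (L.inv_mem h.2)]

/-- The map `⨁_{ℛ} ℤ(G/L) → (⨁_{ℛ} ℤG) ⊗_L ℤ` inverse to the one induced by `cosetMap`. -/
noncomputable def cosetMapInv (L : Subgroup P.G) :
    (P.rels →₀ ((P.G ⧸ L) →₀ ℤ)) →ₗ[ℤ] TensorInt P.freeRep L :=
  Finsupp.lsum ℤ fun ρ => Finsupp.linearCombination ℤ (P.cosetClass L ρ)

theorem cosetMapInv_single (L : Subgroup P.G) (ρ : P.rels) (g : P.G) (n : ℤ) :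
    P.cosetMapInv L (Finsupp.single ρ (Finsupp.single (g : P.G ⧸ L) n)) =
      Representation.Coinvariants.mk (P.freeRep.comp L.subtype)
        (Finsupp.single ρ (Finsupp.single g n)) := by
  rw [cosetMapInv, Finsupp.lsum_single, Finsupp.linearCombination_single, cosetClass_mk,
    ← map_smul, Finsupp.smul_single, Finsupp.smul_single, smul_eq_mul, mul_one]

/-- The identification `(⨁_{ℛ} ℤG) ⊗_L ℤ ≅ ⨁_{ℛ} ℤ(G/L)`, where `G/L` is the set of left cosets,
that sends the class of `g` in the summand of `(l, r)` to the coset `gL` in the summand of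
`(l, r)`. -/
noncomputable def freeTensorEquiv (L : Subgroup P.G) :
    TensorInt P.freeRep L ≃ₗ[ℤ] (P.rels →₀ ((P.G ⧸ L) →₀ ℤ)) :=
  LinearEquiv.ofLinearMap
    (Representation.Coinvariants.lift _ (P.cosetMap L) (P.cosetMap_freeRep L))
    (P.cosetMapInv L)
    (by
      refine Finsupp.lhom_ext' fun ρ => Finsupp.lhom_ext fun c n => ?_
      induction c using QuotientGroup.induction_on with | _ g
      exact (congrArg _ (P.cosetMapInv_single L ρ g n)).trans (P.cosetMap_single L ρ g n))
    (by
      refine Representation.Coinvariants.hom_ext ?_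
      refine Finsupp.lhom_ext' fun ρ => Finsupp.lhom_ext fun g n => ?_
      exact (congrArg _ (P.cosetMap_single L ρ g n)).trans (P.cosetMapInv_single L ρ g n))

/-- The map `π₁(Sq(P), 1) ⊗_L ℤ → ⨁_{ℛ} ℤ(G/L)`. -/
noncomputable def identityTensorMap (L : Subgroup P.G) :
    TensorInt P.pi1Rep L →ₗ[ℤ] (P.rels →₀ ((P.G ⧸ L) →₀ ℤ)) :=
  (P.freeTensorEquiv L).toLinearMap ∘ₗ tensorIntMap P.identityMap L

/-- The map `⨁_{ℛ} ℤ(G/L) → N^ab ⊗_L ℤ`. -/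
noncomputable def relationTensorMap (L : Subgroup P.G) :
    (P.rels →₀ ((P.G ⧸ L) →₀ ℤ)) →ₗ[ℤ] TensorInt P.relationModuleRep L :=
  tensorIntMap P.relationMap L ∘ₗ (P.freeTensorEquiv L).symm.toLinearMap

/-- `P` is `L`-Cockcroft if the map `⨁_{ℛ} ℤ(G/L) → N^ab ⊗_L ℤ` is an isomorphism. -/
def IsCockcroft (L : Subgroup P.G) : Prop :=
  Function.Bijective (P.relationTensorMap L)

end GroupPresentation

namespace GroupPresentation

/-! ### Values of inverse and translated edge paths -/

variable {X : Type u} {P : GroupPresentation X}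

theorem pathValue_invPath (w : List P.Step) : pathValue (invPath w) = -pathValue w := by
  induction w with
  | nil => simp [pathValue, invPath]
  | cons s w ih =>
    have h₁ : invPath (s :: w) = invPath w ++ [Step.inv s] := by simp [invPath]
    have h₂ : pathValue (s :: w) = stepValue s + pathValue w := by simp [pathValue]
    have h₃ : pathValue [Step.inv s] = -stepValue s := by simp [pathValue, stepValue_inv]
    rw [h₁, pathValue_append, ih, h₂, h₃]
    abel

/-- The contribution of an edge records only its relation and `θ(q)`, and left translation changes
only `p`. This is what makes values additive under products of endpoints. -/
theorem pathValue_whisker_left (u : FreeGroup X) (w : List P.Step) :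
    pathValue (w.map (whisker u 1)) = pathValue w := by
  have : (stepValue ∘ whisker u 1 : P.Step → _) = stepValue := by
    funext s
    simp [stepValue, whisker]
  rw [pathValue, List.map_map, this, pathValue]

/-! ### Endpoints and values of edge paths starting at `1` -/

/-- There is an edge path from `1` to `n` whose edges contribute `x`. -/
def HasPath (n : FreeGroup X) (x : P.rels →₀ (P.G →₀ ℤ)) : Prop :=
  ∃ w : List P.Step, IsEdgePath 1 w n ∧ pathValue w = x

namespace HasPath

variable {m n : FreeGroup X} {x y : P.rels →₀ (P.G →₀ ℤ)}

theorem one : HasPath (P := P) 1 0 := ⟨[], rfl, rfl⟩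

theorem mul (hm : HasPath m x) (hn : HasPath n y) : HasPath (m * n) (x + y) := by
  obtain ⟨w, hw, rfl⟩ := hm
  obtain ⟨z, hz, rfl⟩ := hn
  refine ⟨w ++ z.map (whisker m 1), hw.append ?_, ?_⟩
  · simpa using hz.whisker_left m
  · rw [pathValue_append, pathValue_whisker_left]

theorem inv (hn : HasPath n x) : HasPath n⁻¹ (-x) := by
  obtain ⟨w, hw, rfl⟩ := hn
  -- The reversed path runs from `n` to `1`; translating it by `n⁻¹` makes it start at `1` again.
  refine ⟨(invPath w).map (whisker n⁻¹ 1), ?_, ?_⟩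
  · simpa using hw.invPath.whisker_left n⁻¹
  · rw [pathValue_whisker_left, pathValue_invPath]

theorem conj (g : FreeGroup X) (hn : HasPath n x) :
    HasPath (g * n * g⁻¹) (P.freeRep (P.θ g) x) := by
  obtain ⟨w, hw, rfl⟩ := hn
  exact ⟨w.map (whisker g g⁻¹), by simpa using hw.whisker g g⁻¹, pathValue_whisker g w⟩

theorem relator (ρ : P.rels) :
    HasPath (P.relator ρ) (Finsupp.single ρ (Finsupp.single 1 1)) := by
  -- The single edge `(l⁻¹, l, r, 1)` runs from `1` to `l⁻¹ r`.
  refine ⟨[(⟨(P.lhs ρ)⁻¹, ρ, 1⟩, true)], ?_, ?_⟩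
  · simp [IsEdgePath, Step.start, Step.finish, Edge.source, Edge.target,
      GroupPresentation.relator]
  · simp [pathValue, stepValue]

/-- The endpoints of paths from `1` form a normal subgroup containing the relators, hence containing
their normal closure. -/
theorem exists_value (hn : n ∈ P.N) : ∃ x, HasPath (P := P) n x := by
  let K : Subgroup (FreeGroup X) :=
    { carrier := {n | ∃ x, HasPath (P := P) n x}
      one_mem' := ⟨_, one⟩
      mul_mem' := fun ⟨_, ha⟩ ⟨_, hb⟩ => ⟨_, ha.mul hb⟩
      inv_mem' := fun ⟨_, ha⟩ => ⟨_, ha.inv⟩ }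
  have : K.Normal := ⟨fun _ ⟨_, ha⟩ g => ⟨_, ha.conj g⟩⟩
  have hK : P.N ≤ K := by
    refine Subgroup.normalClosure_le_normal ?_
    rintro _ ⟨ρ, rfl⟩
    exact ⟨_, relator ρ⟩
  exact hK hn

/-- The values of paths from `1` form an additive subgroup, and the conjugates of relators supply
every basis element. -/
theorem exists_endpoint (x : P.rels →₀ (P.G →₀ ℤ)) : ∃ n, HasPath n x := by
  let S : AddSubgroup (P.rels →₀ (P.G →₀ ℤ)) :=
    { carrier := {x | ∃ n, HasPath n x}
      zero_mem' := ⟨1, one⟩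
      add_mem' := fun ⟨_, ha⟩ ⟨_, hb⟩ => ⟨_, ha.mul hb⟩
      neg_mem' := fun ⟨_, ha⟩ => ⟨_, ha.inv⟩ }
  change x ∈ S
  induction x using Finsupp.induction_linear with
  | zero => exact S.zero_mem
  | add f g hf hg => exact S.add_mem hf hg
  | single ρ a =>
    induction a using Finsupp.induction_linear with
    | zero => simp
    | add f g hf hg => rw [Finsupp.single_add]; exact S.add_mem hf hg
    | single g k =>
      obtain ⟨q, rfl⟩ := QuotientGroup.mk'_surjective P.N g
      -- Conjugating by `q⁻¹` applies the right action of `θ(q)`, which moves the basis element `1`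
      -- to `θ(q)`.
      have h := (relator ρ).conj q⁻¹
      rw [freeRep_single, one_mul, ← map_inv, inv_inv] at h
      have hS : Finsupp.single ρ (Finsupp.single (P.θ q) (1 : ℤ)) ∈ S := ⟨_, h⟩
      simpa using S.zsmul_mem hS k

/-- Values lie in a commutative group, so a path to `a b a⁻¹ b⁻¹` assembled from paths to `a` and
`b` has value `x + y - x - y = 0`. Both paths exist because `a` and `b` lie in `N`. -/
theorem of_mem_commutator {n : P.N} (hn : n ∈ commutator P.N) :
    HasPath (P := P) (n : FreeGroup X) 0 := by
  let K : Subgroup P.N :=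
    { carrier := {n | HasPath (P := P) (n : FreeGroup X) 0}
      one_mem' := one
      mul_mem' := fun ha hb => by simpa using HasPath.mul ha hb
      inv_mem' := fun ha => by simpa using HasPath.inv ha }
  have : commutator P.N ≤ K := by
    rw [commutator_def, Subgroup.commutator_le]
    intro a _ b _
    obtain ⟨x, hx⟩ := exists_value a.2
    obtain ⟨y, hy⟩ := exists_value b.2
    have h := ((hx.mul hy).mul hx.inv).mul hy.inv
    rw [show x + y + -x + -y = 0 by abel] at h
    simpa [K, commutatorElement_def] using h
  exact this hn

end HasPath

/-! ### The image of a path value in the relation module -/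

/-- For the edge `(p, l, r, q)` the factor `p` cancels in `(p l q)⁻¹ (p r q)`, leaving the conjugate
`q⁻¹ (l⁻¹ r) q` that defines `relationMap`; the opposite orientation gives its inverse. -/
theorem relationMap_stepValue (s : P.Step) :
    ∃ h : (Step.start s)⁻¹ * Step.finish s ∈ P.N,
      P.relationMap (stepValue s) = P.relationClass ⟨_, h⟩ := by
  obtain ⟨⟨p, ρ, q⟩, b⟩ := s
  have hN : q⁻¹ * P.relator ρ * q ∈ P.N := by
    simpa using Subgroup.normalClosure_normal.conj_mem _ (P.relator_mem ρ) q⁻¹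
  have hv := P.relationMap_single ρ q
  have he : (p * P.lhs ρ * q)⁻¹ * (p * P.rhs ρ * q) = q⁻¹ * P.relator ρ * q := by
    simp only [relator]; group
  cases b
  · have he' : (p * P.rhs ρ * q)⁻¹ * (p * P.lhs ρ * q) = (q⁻¹ * P.relator ρ * q)⁻¹ := by
      rw [← he]; group
    refine ⟨he'.symm ▸ P.N.inv_mem hN, ?_⟩
    have h₁ : stepValue ((⟨p, ρ, q⟩, false) : P.Step) =
        -(Finsupp.single ρ (Finsupp.single (P.θ q) 1) : P.rels →₀ (P.G →₀ ℤ)) := by simp [stepValue]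
    rw [h₁, map_neg, hv]
    change P.relationClass (⟨_, hN⟩⁻¹ : P.N) = _
    exact congrArg P.relationClass (Subtype.ext he'.symm)
  · refine ⟨he.symm ▸ hN, ?_⟩
    have h₁ : stepValue ((⟨p, ρ, q⟩, true) : P.Step) =
        Finsupp.single ρ (Finsupp.single (P.θ q) 1) := by simp [stepValue]
    rw [h₁, hv]
    exact congrArg P.relationClass (Subtype.ext he.symm)

/-- The quotients `start⁻¹ * finish` of consecutive edges telescope to `a⁻¹ b`. -/
theorem relationMap_pathValue {a b : FreeGroup X} {w : List P.Step} (hw : IsEdgePath a w b) :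
    ∃ h : a⁻¹ * b ∈ P.N, P.relationMap (pathValue w) = P.relationClass ⟨_, h⟩ := by
  induction w generalizing a with
  | nil =>
    obtain rfl : a = b := hw
    refine ⟨by simp, ?_⟩
    have : (⟨a⁻¹ * a, by simp⟩ : P.N) = 1 := Subtype.ext (inv_mul_cancel a)
    rw [this]
    exact map_zero P.relationMap
  | cons s w ih =>
    obtain ⟨rfl, hw⟩ := hw
    obtain ⟨h₁, e₁⟩ := relationMap_stepValue s
    obtain ⟨h₂, e₂⟩ := ih hw
    have he : (Step.start s)⁻¹ * Step.finish s * ((Step.finish s)⁻¹ * b) =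
        (Step.start s)⁻¹ * b := by group
    refine ⟨he ▸ P.N.mul_mem h₁ h₂, ?_⟩
    have : pathValue (s :: w) = stepValue s + pathValue w := by simp [pathValue]
    rw [this, map_add, e₁, e₂]
    change P.relationClass (⟨_, h₁⟩ * ⟨_, h₂⟩ : P.N) = _
    exact congrArg P.relationClass (Subtype.ext he)

theorem HasPath.relationMap_eq {n : FreeGroup X} {x : P.rels →₀ (P.G →₀ ℤ)} (h : HasPath n x) :
    ∃ hn : n ∈ P.N, P.relationMap x = P.relationClass ⟨n, hn⟩ := by
  obtain ⟨w, hw, rfl⟩ := h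
  simpa using relationMap_pathValue hw

/-! ### Exactness over `G` -/

variable (P) in
theorem relationMap_surjective : Function.Surjective P.relationMap := by
  intro y
  obtain ⟨n, hn⟩ := QuotientGroup.mk_surjective y.toMul
  obtain ⟨x, hx⟩ := HasPath.exists_value n.2
  obtain ⟨_, e⟩ := hx.relationMap_eq
  exact ⟨x, e.trans (congrArg Additive.ofMul hn)⟩

variable (P) in
/-- Exactness of `π₁(Sq(P), 1) → ⨁ ℤG → N^ab`. -/
theorem exact_identityMap_relationMap : Function.Exact P.identityMap P.relationMap := by
  intro x
  constructor
  · intro hx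
    obtain ⟨n, hn⟩ := HasPath.exists_endpoint x
    obtain ⟨hN, e⟩ := hn.relationMap_eq
    -- The class of `n` in `N^ab` is `relationMap x = 0`.
    have hc : (⟨n, hN⟩ : P.N) ∈ commutator P.N := by
      rw [← Abelianization.ker_of, MonoidHom.mem_ker]
      exact congrArg Additive.toMul (e.symm.trans hx)
    -- Now `n` carries both values `x` and `0`; dividing the first pair by the second gives a loop
    -- at `1` of value `x`.
    obtain ⟨w, hw, e'⟩ := hn.mul (HasPath.of_mem_commutator hc).inv
    simp only [mul_inv_cancel, neg_zero, add_zero] at hw e'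
    exact ⟨Additive.ofMul (Pi1.mk w hw), e'⟩
  · rintro ⟨y, rfl⟩
    induction y using Additive.rec with | _ y
    induction y using Pi1.ind with | _ w hw
    obtain ⟨hN, e⟩ := HasPath.relationMap_eq ⟨w, hw, rfl⟩
    exact e.trans (congrArg Additive.ofMul (map_one Abelianization.of))

/-! ### Right exactness of coinvariants -/

section TensorInt

variable {M₁ M₂ M₃ : Type*} [AddCommGroup M₁] [AddCommGroup M₂] [AddCommGroup M₃]
  {τ₁ : Representation ℤ P.G M₁} {τ₂ : Representation ℤ P.G M₂} {τ₃ : Representation ℤ P.G M₃}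

theorem tensorIntMap_mk (f : τ₁.IntertwiningMap τ₂) (L : Subgroup P.G) (x : M₁) :
    tensorIntMap f L (Representation.Coinvariants.mk (τ₁.comp L.subtype) x) =
      Representation.Coinvariants.mk (τ₂.comp L.subtype) (f x) := rfl

theorem tensorIntMap_surjective {f : τ₁.IntertwiningMap τ₂} (hf : Function.Surjective f)
    (L : Subgroup P.G) : Function.Surjective (tensorIntMap f L) := by
  intro y
  obtain ⟨y, rfl⟩ := Representation.Coinvariants.mk_surjective _ y
  obtain ⟨x, rfl⟩ := hf y
  exact ⟨_, tensorIntMap_mk f L x⟩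

/-- Right exactness of `- ⊗_L ℤ`. -/
theorem tensorIntMap_exact {f : τ₁.IntertwiningMap τ₂} {g : τ₂.IntertwiningMap τ₃}
    (hfg : Function.Exact f g) (hg : Function.Surjective g) (L : Subgroup P.G) :
    Function.Exact (tensorIntMap f L) (tensorIntMap g L) := by
  intro y
  constructor
  · intro hy
    obtain ⟨y, rfl⟩ := Representation.Coinvariants.mk_surjective _ y
    rw [tensorIntMap_mk, Representation.Coinvariants.mk_eq_zero] at hy
    -- The submodule killed in the coinvariants of `M₂` maps onto the one of `M₃`: a generator `h z
    -- - z` lifts to `h y - y` for any preimage `y` of `z`, by equivariance of `g`.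
    have key : ∀ z ∈ Representation.Coinvariants.ker (τ₃.comp L.subtype),
        ∃ y ∈ Representation.Coinvariants.ker (τ₂.comp L.subtype), g y = z := by
      intro z hz
      induction hz using Submodule.span_induction with
      | mem z hz =>
        obtain ⟨⟨h, z⟩, rfl⟩ := hz
        obtain ⟨y, rfl⟩ := hg z
        refine ⟨_, Representation.Coinvariants.sub_mem_ker h y, ?_⟩
        rw [map_sub]
        congr 1
        exact LinearMap.congr_fun (g.isIntertwining' h) y
      | zero => exact ⟨0, Submodule.zero_mem _, map_zero g⟩
      | add a b _ _ ha hb =>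
        obtain ⟨a, ha, rfl⟩ := ha
        obtain ⟨b, hb, rfl⟩ := hb
        exact ⟨a + b, Submodule.add_mem _ ha hb, map_add g a b⟩
      | smul c a _ ha =>
        obtain ⟨a, ha, rfl⟩ := ha
        exact ⟨c • a, Submodule.smul_mem _ c ha, map_smul g c a⟩
    obtain ⟨z, hz, e⟩ := key _ hy
    -- Subtracting `z` leaves the class of `y` in the coinvariants unchanged and moves `y` into the
    -- kernel of `g`, so exactness before tensoring applies.
    obtain ⟨x, hx⟩ := (hfg (y - z)).1 (by rw [map_sub, e, sub_self])
    refine ⟨Representation.Coinvariants.mk _ x, ?_⟩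
    rw [tensorIntMap_mk, hx, map_sub, (Representation.Coinvariants.mk_eq_zero _).2 hz, sub_zero]
  · rintro ⟨x, rfl⟩
    obtain ⟨x, rfl⟩ := Representation.Coinvariants.mk_surjective _ x
    rw [tensorIntMap_mk, tensorIntMap_mk, (hfg _).2 ⟨x, rfl⟩, map_zero]

end TensorInt

end GroupPresentation

/-! ### Dyer's criterion -/

theorem mainTheorem7 {X : Type u} (P : GroupPresentation X) (L : Subgroup P.G) :
    P.IsCockcroft L ↔ P.identityTensorMap L = 0 := by
  have hs := GroupPresentation.tensorIntMap_surjective P.relationMap_surjective L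
  have he := GroupPresentation.tensorIntMap_exact P.exact_identityMap_relationMap
    P.relationMap_surjective L
  -- The identification with `⨁ ℤ(G/L)` is bijective, so it can be removed from `β_L`; surjectivity
  -- then reduces the claim to a trivial kernel.
  have hc : P.IsCockcroft L ↔
      Function.Bijective (GroupPresentation.tensorIntMap P.relationMap L) :=
    Function.Bijective.of_comp_iff _ (P.freeTensorEquiv L).symm.bijective
  rw [hc, Function.Bijective, and_iff_left hs, injective_iff_map_eq_zero]
  constructor
  · intro h
    refine LinearMap.ext fun x => ?_
    exact (congrArg (P.freeTensorEquiv L) (h _ ((he _).2 ⟨x, rfl⟩))).trans (map_zero _)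
  · intro h y hy
    obtain ⟨x, rfl⟩ := (he y).1 hy
    apply (P.freeTensorEquiv L).injective
    rw [map_zero]
    exact LinearMap.congr_fun h x
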